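/- Let $K$ be a quadratic field with an embedding $\sigma_\infty:K\to\mathbb R$ and an embedding $\sigma_2:K\to\mathbb Q_2$; write $\alpha_\infty=\sigma_\infty(\alpha)$ and $\alpha_{\langle 2\rangle}=\sigma_2(\alpha)$. For $u=\sum_{n\in\mathbb Z}c_n2^n\in\mathbb Q_2$ with digits $c_n\in\{0,1\}$ and $c_n=0$ for $n<v_2(u)$, put $\lfloor u\rfloor_2=\sum_{n\le 0}c_n2^n\in\mathbb Z[\tfrac12]$. For $\alpha\in K$ let $$b^{(0)}(\alpha)=2m_0+\lfloor\alpha_{\langle2\rangle}\rfloor_2,\qquad b^{(1)}(\alpha)=m_1+\lfloor\alpha_{\langle2\rangle}\rfloor_2,$$ where $m_0$ (resp. $m_1$) is the smallest integer $i$ at which $|\alpha_\infty-2i-\lfloor\alpha_{\langle2\rangle}\rfloor_2|$ (resp. $|\alpha_\infty-i-\lfloor\alpha_{\langle2\rangle}\rfloor_2|$) attains its minimum over $i\in\mathbb Z$. For an integer $n$ let $\tau(n)\in\{0,1\}$ be its parity. Algorithm 1. For $\alpha\in K\setminus\mathbb Q$ put $\alpha_0=\alpha$ and, for $n\ge0$,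 $b_n=b^{(\tau(n))}(\alpha_n)$ and $\alpha_{n+1}=1/(\alpha_n-b_n)$. Its convergents are $p_n/q_n$ with $$\begin{pmatrix}p_n&p_{n-1}\\q_n&q_{n-1}\end{pmatrix}=\begin{pmatrix}b_0&1\\1&0\end{pmatrix}\cdots\begin{pmatrix}b_n&1\\1&0\end{pmatrix}\quad(n\ge0),\qquad p_{-1}=1,\ q_{-1}=0.$$ Algorithm 2. For $\alpha\in K\setminus\mathbb Q$ put $\alpha_{(1)}=\alpha$ and, for $n\ge1$, $a_n=b^{(\tau(n))}(1/\alpha_{(n)})$ and $\alpha_{(n+1)}=1/\alpha_{(n)}-a_n$. Its convergents are $p_n/q_n$ with $$\begin{pmatrix}p_{n-1}&p_n\\q_{n-1}&q_n\end{pmatrix}=\begin{pmatrix}0&1\\1&a_1\end{pmatrix}\cdots\begin{pmatrix}0&1\\1&a_n\end{pmatrix}\quad(n\ge1),\qquad p_0=0,\ q_0=1.$$ (Neither algorithm stops for $\alpha\notin\mathbb Q$, and all $q_n$ are in $\mathbb Z[\tfrac12]\subset\mathbb Q$.) Say that $\alpha$ has property $I$ if $\alpha_\infty\in(-1,1]$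 and $v_2(\alpha_{\langle2\rangle})>0$. Theorem. Let $\alpha\in K\setminus\mathbb Q$. (1) If $\alpha$ has property $I$, then the denominators $q_n$ of the Algorithm 2 convergents of $\alpha$ satisfy $\lim_{n\to\infty}|q_n|=\infty$, where $|\cdot|$ is the real absolute value. (2) Without assuming property $I$, the denominators $q_n$ of the Algorithm 1 convergents of $\alpha$ satisfy $\lim_{n\to\infty}|q_n|=\infty$. -/

import Mathlib

open Filter Topology

namespace SimulCF

/-! ### The `p`-adic floor -/

/-- `c` is the digit sequence of a standard expansion `u = ∑_{n ∈ ℤ} c_n p^n` in `ℚ_p`, with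
digits in `{0, …, p-1}` and `c_n = 0` for `n < v_p(u)`. -/
def IsDigitExpansion (p : ℕ) [Fact p.Prime] (u : ℚ_[p]) (c : ℤ → ℕ) : Prop :=
  (∀ n, c n < p) ∧ (∀ n, n < u.valuation → c n = 0) ∧
    HasSum (fun n : ℤ => (c n : ℚ_[p]) * (p : ℚ_[p]) ^ n) u

theorem norm_hasSum_le {p : ℕ} [Fact p.Prime] {ι : Type*} {f : ι → ℚ_[p]} {s : ℚ_[p]} {C : ℝ}
    (hC : 0 ≤ C) (hf : HasSum f s) (h : ∀ i, ‖f i‖ ≤ C) : ‖s‖ ≤ C := by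
  refine le_of_tendsto (hf.norm) (Eventually.of_forall fun t => ?_)
  exact IsUltrametricDist.norm_sum_le_of_forall_le_of_nonneg hC (fun i _ => h i)

theorem norm_digit_le {p : ℕ} [Fact p.Prime] (k : ℕ) (n : ℤ) :
    ‖(k : ℚ_[p]) * (p : ℚ_[p]) ^ n‖ ≤ (p : ℝ) ^ (-n) := by
  rw [norm_mul, Padic.norm_p_zpow]
  have h1 : ‖(k : ℚ_[p])‖ ≤ 1 := by
    simpa using Padic.norm_int_le_one (p := p) (k : ℤ)
  have h2 : (0 : ℝ) ≤ (p : ℝ) ^ (-n) := by positivity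
  nlinarith

theorem exists_digits_int {p : ℕ} [hp : Fact p.Prime] (x : ℤ_[p]) :
    ∃ c : ℕ → ℕ, (∀ n, c n < p) ∧
      HasSum (fun n : ℕ => (c n : ℚ_[p]) * (p : ℚ_[p]) ^ n) (x : ℚ_[p]) := by
  have hp0 : 0 < p := hp.1.pos
  have hstep : ∀ n, ∃ d : ℕ, x.appr (n + 1) = x.appr n + p ^ n * d := by
    intro n
    obtain ⟨d, hd⟩ := PadicInt.dvd_appr_sub_appr x n (n + 1) (Nat.le_succ n)
    have := PadicInt.appr_mono x (Nat.le_succ n)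
    exact ⟨d, by rw [← hd]; simp only [Nat.succ_eq_add_one] at this; omega⟩
  choose c hc using hstep
  refine ⟨c, fun n => ?_, ?_⟩
  · have h1 := PadicInt.appr_lt x (n + 1)
    rw [hc n, pow_succ] at h1
    have h2 : p ^ n * c n < p ^ n * p := by omega
    exact lt_of_mul_lt_mul_left h2 (Nat.zero_le _)
  have hsum : ∀ n, ∑ i ∈ Finset.range n, (c i : ℚ_[p]) * (p : ℚ_[p]) ^ i = (x.appr n : ℚ_[p]) := by
    intro n
    induction n with
    | zero => simp [PadicInt.appr]
    | succ n ih => rw [Finset.sum_range_succ, ih, hc n]; push_cast; ring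
  have hp1 : (1 : ℝ) < p := by exact_mod_cast hp.1.one_lt
  have hgeo : Tendsto (fun n : ℕ => (p : ℝ) ^ (-n : ℤ)) atTop (𝓝 0) := by
    have := tendsto_pow_atTop_nhds_zero_of_lt_one (r := (p : ℝ)⁻¹) (by positivity)
      (inv_lt_one_of_one_lt₀ hp1)
    simpa [zpow_neg, inv_pow] using this
  have hsummable : Summable (fun n : ℕ => (c n : ℚ_[p]) * (p : ℚ_[p]) ^ n) := by
    apply NonarchimedeanAddGroup.summable_of_tendsto_cofinite_zero
    rw [Nat.cofinite_eq_atTop]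
    refine squeeze_zero_norm (fun n => ?_) hgeo
    simpa using norm_digit_le (p := p) (c n) (n : ℤ)
  rw [hsummable.hasSum_iff_tendsto_nat]
  simp only [hsum]
  rw [tendsto_iff_norm_sub_tendsto_zero]
  refine squeeze_zero (fun n => norm_nonneg _) (fun n => ?_) hgeo
  have h1 := (PadicInt.norm_le_pow_iff_mem_span_pow _ n).2 (PadicInt.appr_spec n x)
  rw [norm_sub_rev]
  simpa [PadicInt.norm_def] using h1

theorem exists_isDigitExpansion (p : ℕ) [hp : Fact p.Prime] (u : ℚ_[p]) :
    ∃ c, IsDigitExpansion p u c := by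
  have hpne : (p : ℚ_[p]) ≠ 0 := by exact_mod_cast hp.1.ne_zero
  set v := u.valuation with hv
  have hx : ‖u * (p : ℚ_[p]) ^ (-v)‖ ≤ 1 := by
    rcases eq_or_ne u 0 with h0 | h0
    · simp [h0]
    · have hp0 : (p : ℝ) ≠ 0 := by exact_mod_cast hp.1.ne_zero
      rw [norm_mul, Padic.norm_p_zpow, Padic.norm_eq_zpow_neg_valuation h0, ← hv,
        ← zpow_add₀ hp0]
      simp
  obtain ⟨c, hc1, hc2⟩ := exists_digits_int (p := p) ⟨u * (p : ℚ_[p]) ^ (-v), hx⟩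
  have hinj : Function.Injective (fun i : ℕ => v + (i : ℤ)) := by
    intro a b h; simpa using h
  refine ⟨fun n => if v ≤ n then c (n - v).toNat else 0, fun n => ?_, fun n hn => ?_, ?_⟩
  · dsimp only
    split_ifs
    · exact hc1 _
    · exact hp.1.pos
  · exact if_neg (not_le.2 hn)
  · rw [← hinj.hasSum_iff]
    · have h := hc2.mul_right ((p : ℚ_[p]) ^ v)
      have e1 : ((fun n : ℤ => (((if v ≤ n then c (n - v).toNat else 0 : ℕ)) : ℚ_[p])
          * (p : ℚ_[p]) ^ n) ∘ fun i : ℕ => v + (i : ℤ)) =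
          fun i : ℕ => (c i : ℚ_[p]) * (p : ℚ_[p]) ^ i * (p : ℚ_[p]) ^ v := by
        funext i
        simp [zpow_add₀ hpne]
        ring
      have e2 : u * (p : ℚ_[p]) ^ (-v) * (p : ℚ_[p]) ^ v = u := by
        rw [mul_assoc, ← zpow_add₀ hpne]; simp
      rw [e1]
      change HasSum _ (u * (p : ℚ_[p]) ^ (-v) * (p : ℚ_[p]) ^ v) at h
      rwa [e2] at h
    · intro n hn
      have : ¬ v ≤ n := fun h => hn ⟨(n - v).toNat, by simp [Int.toNat_of_nonneg (sub_nonneg.2 h)]⟩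
      simp [this]

theorem isDigitExpansion_unique {p : ℕ} [hp : Fact p.Prime] {u : ℚ_[p]} {c d : ℤ → ℕ}
    (hc : IsDigitExpansion p u c) (hd : IsDigitExpansion p u d) : c = d := by
  by_contra hne
  obtain ⟨n₀, hn₀⟩ : ∃ n, c n ≠ d n := by
    by_contra h; push Not at h; exact hne (funext h)
  obtain ⟨N, hN, hmin⟩ := Int.exists_least_of_bdd (P := fun n => c n ≠ d n)
    ⟨u.valuation, fun n hn => by
      by_contra h
      exact hn (by rw [hc.2.1 n (not_le.1 h), hd.2.1 n (not_le.1 h)])⟩ ⟨n₀, hn₀⟩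
  have hp1 : (1 : ℝ) < p := by exact_mod_cast hp.1.one_lt
  set f : ℤ → ℚ_[p] := fun n => (c n : ℚ_[p]) * (p : ℚ_[p]) ^ n - (d n : ℚ_[p]) * (p : ℚ_[p]) ^ n
  have hf : HasSum f 0 := by simpa using hc.2.2.sub hd.2.2
  have hf' := hf.sub (hasSum_ite_eq N (f N))
  have hb : ‖(0 : ℚ_[p]) - f N‖ ≤ (p : ℝ) ^ (-(N + 1)) := by
    refine norm_hasSum_le (by positivity) hf' (fun n => ?_)
    rcases lt_trichotomy n N with h | h | h
    · have : c n = d n := by by_contra h'; exact absurd (hmin n h') (not_le.2 h)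
      simp only [f, this, sub_self, h.ne, if_false, norm_zero]; positivity
    · simp only [h, if_true, sub_self, norm_zero]; positivity
    · simp only [h.ne', if_false, sub_zero]
      have hle : (p : ℝ) ^ (-n) ≤ (p : ℝ) ^ (-(N + 1)) :=
        zpow_le_zpow_right₀ hp1.le (by omega)
      rw [show f n = (c n : ℚ_[p]) * (p : ℚ_[p]) ^ n + -((d n : ℚ_[p]) * (p : ℚ_[p]) ^ n) from
        sub_eq_add_neg _ _]
      refine (Padic.nonarchimedean _ _).trans ?_
      rw [norm_neg]
      exact (max_le ((norm_digit_le _ _).trans hle) ((norm_digit_le _ _).trans hle))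
  have hfN : f N = (((c N : ℤ) - (d N : ℤ) : ℤ) : ℚ_[p]) * (p : ℚ_[p]) ^ N := by
    simp only [f]; push_cast; ring
  have h1 : ‖(((c N : ℤ) - (d N : ℤ) : ℤ) : ℚ_[p])‖ = 1 := by
    refine le_antisymm (Padic.norm_int_le_one _) (not_lt.1 fun hlt => ?_)
    rw [Padic.norm_intCast_lt_one_iff] at hlt
    have := hc.1 N
    have := hd.1 N
    have := Int.eq_zero_of_abs_lt_dvd hlt (by rw [abs_lt]; constructor <;> omega)
    exact hN (by omega)
  rw [zero_sub, norm_neg, hfN, norm_mul, h1, one_mul, Padic.norm_p_zpow] at hb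
  have : (p : ℝ) ^ (-(N + 1)) < (p : ℝ) ^ (-N) := zpow_lt_zpow_right₀ hp1 (by omega)
  linarith

/-- The standard digits of `u ∈ ℚ_p`. -/
noncomputable def digit (p : ℕ) [Fact p.Prime] (u : ℚ_[p]) : ℤ → ℕ :=
  (exists_isDigitExpansion p u).choose

theorem digit_spec (p : ℕ) [Fact p.Prime] (u : ℚ_[p]) : IsDigitExpansion p u (digit p u) :=
  (exists_isDigitExpansion p u).choose_spec

/-- The `p`-adic floor `⌊u⌋_p = ∑_{n ≤ 0} c_n p^n`, an element of `ℤ[1/p] ⊆ ℚ`. The sum is finite,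
since `c_n = 0` for `n < v_p(u)`. -/
noncomputable def padicFloor (p : ℕ) [Fact p.Prime] (u : ℚ_[p]) : ℚ :=
  ∑ n ∈ Finset.Icc u.valuation 0, (digit p u n : ℚ) * (p : ℚ) ^ n

/-! ### The algorithms

Throughout, `K` is a field with embeddings `σ∞ : K → ℝ` and `σp : K → ℚ_p`. -/

/-- The smallest `m ∈ ℤ` among the `i ∈ ℤ` at which `|x - i s|` attains its minimum. -/
noncomputable def leastMinimizer (x s : ℝ) : ℤ :=
  sInf {i : ℤ | ∀ j : ℤ, |x - i * s| ≤ |x - j * s|}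

/-- For `s > 0` the minimum is attained and there is a smallest minimizer. -/
theorem leastMinimizer_isLeast (x : ℝ) {s : ℝ} (hs : 0 < s) :
    IsLeast {i : ℤ | ∀ j : ℤ, |x - i * s| ≤ |x - j * s|} (leastMinimizer x s) := by
  have hne : {i : ℤ | ∀ j : ℤ, |x - i * s| ≤ |x - j * s|}.Nonempty := by
    refine ⟨round (x / s), fun j => ?_⟩
    have h := round_le (x / s) j
    have key : ∀ i : ℤ, |x - i * s| = |x / s - i| * s := by
      intro i
      rw [← abs_of_pos hs, ← abs_mul, abs_of_pos hs]
      congr 1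
      field_simp
    rw [key, key]
    exact mul_le_mul_of_nonneg_right h hs.le
  have hbdd : BddBelow {i : ℤ | ∀ j : ℤ, |x - i * s| ≤ |x - j * s|} := by
    refine ⟨⌊(x - |x|) / s⌋, fun i hi => ?_⟩
    have h := hi 0
    simp only [Int.cast_zero, zero_mul, sub_zero] at h
    have h1 : x - i * s ≤ |x| := (le_abs_self _).trans h
    have h2 : (x - |x|) / s ≤ i := by rw [div_le_iff₀ hs]; linarith
    exact_mod_cast (Int.floor_le _).trans h2
  exact ⟨Int.csInf_mem hne hbdd, fun i hi => csInf_le hbdd hi⟩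

/-- The step: `p` for even indices, `1` for odd indices. -/
def step (p n : ℕ) : ℕ := if Even n then p else 1

section Algorithms

variable (p : ℕ) [Fact p.Prime] {K : Type*} [Field K]
  (σinf : K →+* ℝ) (σp : K →+* ℚ_[p])

/-- `b^{(0)}(α) = m p + ⌊α_p⌋_p` (for `n` even) and `b^{(1)}(α) = m + ⌊α_p⌋_p` (for `n` odd), where
`m` is the smallest integer `i` minimizing `|α_∞ - i p - ⌊α_p⌋_p|`, respectively
`|α_∞ - i - ⌊α_p⌋_p|`. -/
noncomputable def bFun (n : ℕ) (α : K) : ℚ :=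
  (leastMinimizer (σinf α - (padicFloor p (σp α) : ℝ)) (step p n : ℝ) : ℚ) * (step p n : ℚ)
    + padicFloor p (σp α)

/-- `F_{p,0}` (`n` even) and `F_{p,1}` (`n` odd). For `α` outside `ℚ` the denominator is not `0`. -/
noncomputable def F (n : ℕ) (α : K) : K := 1 / (α - (bFun p σinf σp n α : K))

/-- The complete quotients `α_n`, `n ≥ 0`, of the first algorithm. -/
noncomputable def alpha (α : K) : ℕ → K
  | 0 => α
  | n + 1 => F p σinf σp n (alpha α n)

/-- The partial quotients `b_n(α)`, `n ≥ 0`, of the first algorithm. -/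
noncomputable def b (α : K) (n : ℕ) : ℚ := bFun p σinf σp n (alpha p σinf σp α n)

/-- The matrix product `∏_{k=0}^{n} !![b_k, 1; 1, 0] = !![p_n, p_{n-1}; q_n, q_{n-1}]`. -/
noncomputable def convMatrix₁ (α : K) : ℕ → Matrix (Fin 2) (Fin 2) ℚ
  | 0 => !![b p σinf σp α 0, 1; 1, 0]
  | n + 1 => convMatrix₁ α n * !![b p σinf σp α (n + 1), 1; 1, 0]

/-- The denominators `q_n` of the convergents of the first algorithm. -/
noncomputable def q₁ (α : K) (n : ℕ) : ℚ := convMatrix₁ p σinf σp α n 1 0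

/-- Property I: `α_∞ ∈ (-p/2, p/2]` and `v_p(α_p) > 0` (with `v_p(0) = ∞`). -/
def PropertyI (α : K) : Prop :=
  σinf α ∈ Set.Ioc (-(p : ℝ) / 2) ((p : ℝ) / 2) ∧ 0 < Padic.addValuation (σp α)

/-- `a^{(0)}(α)` (`n` even) and `a^{(1)}(α)` (`n` odd): the rational number
`b^{(0)}`, `b^{(1)}` of `1/α`. -/
noncomputable def aFun (n : ℕ) (α : K) : ℚ := bFun p σinf σp n (1 / α)

/-- `T_{p,0}` (`n` even) and `T_{p,1}` (`n` odd). -/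
noncomputable def T (n : ℕ) (α : K) : K := 1 / α - (aFun p σinf σp n α : K)

/-- The sequence `α_{(n)}`, `n ≥ 1`, of the second algorithm: `α_{(1)} = α`, and `α_{(n+1)}` is
`T_{p,0}(α_{(n)})` or `T_{p,1}(α_{(n)})` as `n` is even or odd. The index `0` is not used. -/
noncomputable def alphaT (α : K) : ℕ → K
  | 0 => α
  | 1 => α
  | n + 2 => T p σinf σp (n + 1) (alphaT α (n + 1))

/-- The partial quotients `a_n(α)`, `n ≥ 1`, of the second algorithm. -/
noncomputable def a (α : K) (n : ℕ) : ℚ := aFun p σinf σp n (alphaT p σinf σp α n)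

/-- The matrix product `∏_{k=1}^{n} !![0, 1; 1, a_k] = !![p_{n-1}, p_n; q_{n-1}, q_n]`. -/
noncomputable def convMatrix₂ (α : K) : ℕ → Matrix (Fin 2) (Fin 2) ℚ
  | 0 => 1
  | n + 1 => convMatrix₂ α n * !![0, 1; 1, a p σinf σp α (n + 1)]

/-- The denominators `q_n` of the convergents of the second algorithm. -/
noncomputable def q₂ (α : K) (n : ℕ) : ℚ := convMatrix₂ p σinf σp α n 1 1

variable [CharZero K]

/-- Neither algorithm halts at an element outside `ℚ`: all `α_n` and `α_{(n)}` stay outside `ℚ`. -/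
theorem alpha_notMem_rat {α : K} (hα : α ∉ Set.range ((↑) : ℚ → K)) (n : ℕ) :
    alpha p σinf σp α n ∉ Set.range ((↑) : ℚ → K) := by
  induction n with
  | zero => exact hα
  | succ n ih =>
    rintro ⟨r, hr⟩
    refine ih ⟨r⁻¹ + bFun p σinf σp n (alpha p σinf σp α n), ?_⟩
    rw [alpha, F] at hr
    push_cast
    rw [hr]
    simp

theorem alphaT_notMem_rat {α : K} (hα : α ∉ Set.range ((↑) : ℚ → K)) (n : ℕ) :
    alphaT p σinf σp α n ∉ Set.range ((↑) : ℚ → K) := by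
  induction n with
  | zero => exact hα
  | succ n ih =>
    cases n with
    | zero => exact hα
    | succ n =>
      rintro ⟨r, hr⟩
      refine ih ⟨(r + aFun p σinf σp (n + 1) (alphaT p σinf σp α (n + 1)))⁻¹, ?_⟩
      rw [alphaT, T] at hr
      push_cast
      rw [hr]
      simp

end Algorithms

end SimulCF

namespace SimulCF

/-! ### The ring `ℤ[1/2]` and the product formula -/

/-! Write x_n for the complete quotients, so x_{n+1} = 1/x_n - a_n, with real bound s_n/2 where s_n
alternates 2, 1, 2, 1, ..., and with 2-adic norm at most 1. Let P_n = x_0⋯x_{n-1}; since the bounds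
alternate between 1 and 1/2, |P_n| ≤ 2^{-⌊n/2⌋}. The identity (q_n + q_{n-1} x_n) P_n = 1 gives q_n
P_n = 1 - w_n x_n with w_n = q_{n-1} P_n. The recursion w_{n+1} = x_n (1 - x_n w_n) and s_n s_{n+1}
= 2 give |w_n| ≤ s_{n+1}, hence |w_n x_n| ≤ 1. This only just fails to bound q_n P_n away from 0:
one needs |x_n| to stay a fixed distance below s_n/2.

That gap (`exists_le_sub_abs`) is where K being quadratic enters. Let X = ±s_n/2 be the endpoint on
the side of x_n, and evaluate the norm form of α at u = p_n + p_{n-1} X, v = q_n + q_{n-1} X. The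
value is nonzero and lies in ℤ[1/2] up to a fixed denominator, so the product of its real and 2-adic
absolute values is bounded below. Yet it equals X - x_n times a quantity bounded at both places.
Therefore |X - x_n| ≥ c > 0 uniformly in n, and |q_n| ≥ c·2^{⌊n/2⌋}.

Algorithm 1 reduces to Algorithm 2 started at α - b_0, which satisfies the required bounds
automatically. -/

/-- The ring `ℤ[1/2]` inside `ℚ`. -/
def dyadic : Subring ℚ := Subring.closure {(1 / 2 : ℚ)}

theorem half_mem_dyadic : (1 / 2 : ℚ) ∈ dyadic := Subring.subset_closure rfl

theorem exists_mul_two_pow_eq_intCast {r : ℚ} (hr : r ∈ dyadic) :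
    ∃ (k : ℕ) (m : ℤ), r * 2 ^ k = m := by
  induction hr using Subring.closure_induction with
  | mem x hx => exact ⟨1, 1, by rw [Set.mem_singleton_iff.1 hx]; norm_num⟩
  | zero => exact ⟨0, 0, by simp⟩
  | one => exact ⟨0, 1, by simp⟩
  | add x y _ _ hx hy =>
    obtain ⟨k, m, h⟩ := hx
    obtain ⟨l, n, h'⟩ := hy
    exact ⟨k + l, m * 2 ^ l + n * 2 ^ k, by push_cast; rw [← h, ← h']; ring⟩
  | neg x _ hx =>
    obtain ⟨k, m, h⟩ := hx
    exact ⟨k, -m, by push_cast; rw [← h]; ring⟩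
  | mul x y _ _ hx hy =>
    obtain ⟨k, m, h⟩ := hx
    obtain ⟨l, n, h'⟩ := hy
    exact ⟨k + l, m * n, by push_cast; rw [← h, ← h']; ring⟩

/-- The product is the odd part of |m|. -/
theorem one_le_abs_mul_norm_intCast {m : ℤ} (hm : m ≠ 0) :
    1 ≤ |(m : ℝ)| * ‖(m : ℚ_[2])‖ := by
  have hv : 2 ^ padicValInt 2 m ≤ m.natAbs :=
    Nat.le_of_dvd (Int.natAbs_pos.2 hm) pow_padicValNat_dvd
  have hm' : (m : ℚ_[2]) ≠ 0 := by exact_mod_cast hm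
  rw [Padic.norm_eq_zpow_neg_valuation hm', Padic.valuation_intCast, zpow_neg, zpow_natCast]
  rw [← div_eq_mul_inv, one_le_div (by positivity), ← Int.cast_abs, Int.abs_eq_natAbs]
  exact_mod_cast hv

/-- A nonzero element of `ℤ[1/2]` is not small both in `ℝ` and in `ℚ_2`. -/
theorem one_le_abs_mul_norm {r : ℚ} (hr : r ∈ dyadic) (h0 : r ≠ 0) :
    1 ≤ |(r : ℝ)| * ‖(r : ℚ_[2])‖ := by
  obtain ⟨k, m, h⟩ := exists_mul_two_pow_eq_intCast hr
  have hm : m ≠ 0 := by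
    rintro rfl
    simp [h0] at h
  have h1 := one_le_abs_mul_norm_intCast hm
  have e1 : (m : ℝ) = r * 2 ^ k := by exact_mod_cast h.symm
  have e2 : (m : ℚ_[2]) = r * 2 ^ k := by exact_mod_cast congrArg (Rat.cast (K := ℚ_[2])) h.symm
  have e3 : ‖(2 : ℚ_[2])‖ = 2⁻¹ := by simpa using Padic.norm_p (p := 2)
  rw [e1, e2, abs_mul, norm_mul, norm_pow, e3, abs_of_pos (by positivity : (0 : ℝ) < 2 ^ k)] at h1
  calc (1 : ℝ) ≤ _ := h1
    _ = |(r : ℝ)| * ‖(r : ℚ_[2])‖ * (2 ^ k * (2⁻¹) ^ k) := by ring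
    _ = _ := by rw [← mul_pow]; norm_num

/-! ### The dyadic floor and the partial quotients -/

theorem padicFloor_mem_dyadic (u : ℚ_[2]) : padicFloor 2 u ∈ dyadic := by
  refine Subring.sum_mem _ fun n hn => Subring.mul_mem _ (natCast_mem _ _) ?_
  obtain ⟨k, hk⟩ := Int.eq_ofNat_of_zero_le (neg_nonneg.2 (Finset.mem_Icc.1 hn).2)
  have : ((2 : ℕ) : ℚ) ^ n = (1 / 2) ^ k := by
    rw [← neg_neg n, hk, zpow_neg]; simp
  rw [this]
  exact Subring.pow_mem _ half_mem_dyadic k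

/-- Removing the floor leaves only the digits at positions n ≥ 1. -/
theorem norm_sub_padicFloor_le (p : ℕ) [hp : Fact p.Prime] (u : ℚ_[p]) :
    ‖u - (padicFloor p u : ℚ_[p])‖ ≤ (p : ℝ)⁻¹ := by
  obtain ⟨-, h0, hs⟩ := digit_spec p u
  set f : ℤ → ℚ_[p] := fun n => (digit p u n : ℚ_[p]) * (p : ℚ_[p]) ^ n with hf
  have hp1 : (1 : ℝ) < p := by exact_mod_cast hp.1.one_lt
  have e : (padicFloor p u : ℚ_[p]) = ∑ n ∈ Finset.Icc u.valuation 0, f n := by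
    simp [padicFloor, hf]
  have hfin : HasSum (fun n => if n ∈ Finset.Icc u.valuation 0 then f n else 0)
      (∑ n ∈ Finset.Icc u.valuation 0, f n) := by
    rw [← Finset.sum_congr rfl fun n (hn : n ∈ Finset.Icc u.valuation 0) =>
      if_pos (c := n ∈ Finset.Icc u.valuation 0) (t := f n) (e := 0) hn]
    exact hasSum_sum_of_ne_finset_zero fun n hn => if_neg hn
  rw [e]
  refine norm_hasSum_le (by positivity) (hs.sub hfin) fun n => ?_
  by_cases hn : n ∈ Finset.Icc u.valuation 0
  · simp only [hn, if_true, hf, sub_self, norm_zero]; positivity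
  · simp only [hn, if_false, sub_zero]
    rw [Finset.mem_Icc, not_and_or, not_le, not_le] at hn
    rcases hn with hn | hn
    · simp only [hf, h0 n hn, Nat.cast_zero, zero_mul, norm_zero]; positivity
    · refine (norm_digit_le _ n).trans ?_
      rw [← zpow_neg_one]
      exact zpow_le_zpow_right₀ hp1.le (by omega)

section PartialQuotients

variable {K : Type*} [Field K] (σinf : K →+* ℝ) (σp : K →+* ℚ_[2])

theorem bFun_mem_dyadic (n : ℕ) (α : K) : bFun 2 σinf σp n α ∈ dyadic :=
  Subring.add_mem _ (Subring.mul_mem _ (intCast_mem _ _) (natCast_mem _ _))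
    (padicFloor_mem_dyadic _)

theorem abs_sub_leastMinimizer_le (x : ℝ) {s : ℝ} (hs : 0 < s) :
    |x - leastMinimizer x s * s| ≤ s / 2 := by
  refine ((leastMinimizer_isLeast x hs).1 (round (x / s))).trans ?_
  have h := abs_sub_round (x / s)
  have e : x - round (x / s) * s = (x / s - round (x / s)) * s := by field_simp
  rw [e, abs_mul, abs_of_pos hs]
  nlinarith

theorem step_pos (n : ℕ) : (0 : ℝ) < step 2 n := by
  unfold step; split_ifs <;> norm_num

theorem abs_sub_bFun_le [CharZero K] (n : ℕ) (α : K) :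
    |σinf (α - (bFun 2 σinf σp n α : K))| ≤ (step 2 n : ℝ) / 2 := by
  have h := abs_sub_leastMinimizer_le (σinf α - (padicFloor 2 (σp α) : ℝ)) (step_pos n)
  rw [map_sub, map_ratCast, bFun]
  push_cast
  rwa [sub_add_eq_sub_sub_swap]

/-- The places trade off: for even n the multiple of 2 preserves 2-adic smallness, at the price of a
real bound 1 instead of 1/2; for odd n an arbitrary integer is subtracted and only integrality
survives. -/
theorem norm_sub_bFun_le [CharZero K] (n : ℕ) (α : K) :
    ‖σp (α - (bFun 2 σinf σp n α : K))‖ ≤ (step 2 (n + 1) : ℝ) / 2 := by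
  have h := norm_sub_padicFloor_le 2 (σp α)
  rw [map_sub, map_ratCast, bFun]
  set m := leastMinimizer (σinf α - (padicFloor 2 (σp α) : ℝ)) (step 2 n : ℝ)
  push_cast at h ⊢
  rw [sub_add_eq_sub_sub_swap, sub_eq_add_neg]
  refine (Padic.nonarchimedean _ _).trans (max_le (h.trans ?_) ?_)
  · unfold step; split_ifs <;> norm_num
  · have h1 := Padic.norm_int_le_one (p := 2) m
    have e3 : ‖(2 : ℚ_[2])‖ = 2⁻¹ := by simpa using Padic.norm_p (p := 2)
    rw [norm_neg, norm_mul]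
    rcases Nat.even_or_odd n with hn | hn
    · have : ¬ Even (n + 1) := by simpa [Nat.even_add_one] using hn
      simp only [step, hn, this, if_true, if_false, Nat.cast_ofNat, e3]
      norm_num
      exact h1
    · have h2 : Even (n + 1) := by simpa [Nat.even_add_one] using hn
      have h3 : ¬ Even n := by simpa using hn
      simp only [step, h2, h3, if_true, if_false]
      simpa using h1

end PartialQuotients

/-! ### Continued fractions with partial quotients in `ℚ` -/

/-- The product `∏_{k < n} !![0, 1; 1, a k]`. -/
def contProd (a : ℕ → ℚ) : ℕ → Matrix (Fin 2) (Fin 2) ℚ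
  | 0 => 1
  | n + 1 => contProd a n * !![0, 1; 1, a n]

section Continuants

variable (a : ℕ → ℚ)

theorem contProd_succ_left (n : ℕ) (i : Fin 2) : contProd a (n + 1) i 0 = contProd a n i 1 := by
  simp [contProd, Matrix.mul_apply, Fin.sum_univ_two]

theorem contProd_succ_right (n : ℕ) (i : Fin 2) :
    contProd a (n + 1) i 1 = contProd a n i 0 + contProd a n i 1 * a n := by
  simp [contProd, Matrix.mul_apply, Fin.sum_univ_two]

variable {a}

theorem contProd_mem_dyadic (ha : ∀ n, a n ∈ dyadic) (n : ℕ) (i j : Fin 2) :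
    contProd a n i j ∈ dyadic := by
  induction n generalizing i j with
  | zero =>
    fin_cases i <;> fin_cases j <;> simp [contProd]
  | succ n ih =>
    fin_cases j
    · exact contProd_succ_left a n i ▸ ih i 1
    · exact contProd_succ_right a n i ▸
        Subring.add_mem _ (ih i 0) (Subring.mul_mem _ (ih i 1) (ha n))

variable {K : Type*} [Field K] [CharZero K] {x : ℕ → K}

/-- Substituting x_{n+1} = 1/x_n - a_n cancels the partial quotient: q_{n+1} + q_n x_{n+1} = (q_n +
q_{n-1} x_n)/x_n. -/
theorem contProd_one_mul_prod (hx0 : ∀ n, x n ≠ 0) (hx : ∀ n, x (n + 1) = 1 / x n - a n) (n : ℕ) :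
    ((contProd a n 1 1 : K) + contProd a n 1 0 * x n) * ∏ i ∈ Finset.range n, x i = 1 := by
  induction n with
  | zero => simp [contProd]
  | succ n ih =>
    refine Eq.trans ?_ ih
    rw [contProd_succ_left, contProd_succ_right, hx, Finset.prod_range_succ]
    push_cast
    have := hx0 n
    field_simp
    ring

theorem contProd_zero_sub (hx0 : ∀ n, x n ≠ 0) (hx : ∀ n, x (n + 1) = 1 / x n - a n) (n : ℕ) :
    ((contProd a n 0 0 : K) - x 0 * contProd a n 1 0 = (-1) ^ n * ∏ i ∈ Finset.range n, x i) ∧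
    ((contProd a n 0 1 : K) - x 0 * contProd a n 1 1 =
      -((-1) ^ n * (∏ i ∈ Finset.range n, x i) * x n)) := by
  induction n with
  | zero => simp [contProd]
  | succ n ih =>
    obtain ⟨h0, h1⟩ := ih
    have := hx0 n
    rw [contProd_succ_left, contProd_succ_left, contProd_succ_right, contProd_succ_right, hx,
      Finset.prod_range_succ]
    push_cast
    constructor
    · rw [h1]; ring
    · calc _ = ((contProd a n 0 0 : K) - x 0 * contProd a n 1 0) +
            ((contProd a n 0 1 : K) - x 0 * contProd a n 1 1) * a n := by ring
        _ = _ := by rw [h0, h1]; field_simp; ring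

/-- The normalized denominators `w n = q_{n-1} ∏_{i < n} x i` satisfy a recursion that does not
involve the partial quotients. -/
theorem normalized_denom_succ (hx0 : ∀ n, x n ≠ 0) (hx : ∀ n, x (n + 1) = 1 / x n - a n) (n : ℕ) :
    (contProd a (n + 1) 1 0 : K) * ∏ i ∈ Finset.range (n + 1), x i =
      x n * (1 - x n * (contProd a n 1 0 * ∏ i ∈ Finset.range n, x i)) := by
  rw [contProd_succ_left, Finset.prod_range_succ, ← contProd_one_mul_prod hx0 hx n]
  ring

end Continuants

end SimulCF

namespace SimulCF

/-! ### Norm forms of quadratic fields -/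

theorem exists_sq_eq_of_finrank_eq_two {K : Type*} [Field K] [CharZero K] [Algebra ℚ K]
    (hK : Module.finrank ℚ K = 2) {α : K} (hα : α ∉ Set.range ((↑) : ℚ → K)) :
    ∃ t N : ℚ, α ^ 2 = t * α - N := by
  have : Module.Finite ℚ K := Module.finite_of_finrank_eq_succ hK
  -- In dimension 2 the elements 1, α, α² are dependent; irrationality of α forces a nonzero
  -- coefficient at α².
  have hdep : ¬ LinearIndependent ℚ (fun i : Fin 3 => α ^ (i : ℕ)) := fun h => by
    have := h.fintype_card_le_finrank
    simp [hK] at this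
  obtain ⟨g, hg, i, hi⟩ := Fintype.not_linearIndependent_iff.1 hdep
  simp only [Fin.sum_univ_three, Algebra.smul_def, eq_ratCast, Fin.val_zero, Fin.val_one,
    Fin.val_two, pow_zero, pow_one, mul_one] at hg
  have h2 : g 2 ≠ 0 := by
    intro h2
    rw [h2, Rat.cast_zero, zero_mul, add_zero] at hg
    have h1 : g 1 = 0 := by
      by_contra h1
      have h1' : (g 1 : K) ≠ 0 := by exact_mod_cast h1
      refine hα ⟨-g 0 / g 1, ?_⟩
      push_cast
      rw [div_eq_iff h1']
      linear_combination -hg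
    rw [h1, Rat.cast_zero, zero_mul, add_zero] at hg
    have h0 : g 0 = 0 := by exact_mod_cast hg
    fin_cases i <;> simp_all
  have h2' : (g 2 : K) ≠ 0 := by exact_mod_cast h2
  refine ⟨-g 1 / g 2, g 0 / g 2, ?_⟩
  push_cast
  field_simp
  linear_combination hg

/-- The product formula for the values of a binary quadratic form at points of `ℤ[1/2]`. -/
theorem exists_le_abs_mul_norm_quadForm (t N : ℚ) :
    ∃ C : ℝ, 0 < C ∧ ∀ u ∈ dyadic, ∀ v ∈ dyadic, u ^ 2 - t * u * v + N * v ^ 2 ≠ 0 →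
      C ≤ |((u ^ 2 - t * u * v + N * v ^ 2 : ℚ) : ℝ)| *
        ‖((u ^ 2 - t * u * v + N * v ^ 2 : ℚ) : ℚ_[2])‖ := by
  -- D clears the denominators of the form. Its 2-adic norm is at most 1, so clearing them costs at
  -- most a factor D.
  set D : ℕ := t.den * N.den with hD
  have hDpos : 0 < D := Nat.mul_pos t.den_pos N.den_pos
  refine ⟨(D : ℝ)⁻¹, by positivity, fun u hu v hv h0 => ?_⟩
  set f := u ^ 2 - t * u * v + N * v ^ 2 with hf
  have hmem : (D : ℚ) * f ∈ dyadic := by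
    have e : (D : ℚ) * f = D * u ^ 2 - (t.num * N.den : ℚ) * u * v + (N.num * t.den : ℚ) * v ^ 2 := by
      rw [hf, hD, ← Rat.mul_den_eq_num, ← Rat.mul_den_eq_num]
      push_cast
      ring
    rw [e]
    exact add_mem (sub_mem (mul_mem (natCast_mem _ _) (pow_mem hu 2))
      (mul_mem (mul_mem (mul_mem (intCast_mem _ _) (natCast_mem _ _)) hu) hv))
      (mul_mem (mul_mem (intCast_mem _ _) (natCast_mem _ _)) (pow_mem hv 2))
  have h1 := one_le_abs_mul_norm hmem (mul_ne_zero (by exact_mod_cast hDpos.ne') h0)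
  have h2 : ‖(D : ℚ_[2])‖ ≤ 1 := by simpa using Padic.norm_int_le_one (p := 2) (D : ℤ)
  rw [Rat.cast_mul, Rat.cast_mul, Rat.cast_natCast, Rat.cast_natCast, abs_mul, norm_mul, Nat.abs_cast] at h1
  rw [inv_le_iff_one_le_mul₀ (by positivity)]
  have h3 : 0 ≤ D * (|(f : ℝ)| * ‖(f : ℚ_[2])‖) := by positivity
  nlinarith

/-- The form splits as (u - αv)(u - (t - α)v), where t - α is the conjugate root. If the second
factor vanished with v ≠ 0, then α would be rational; if v = 0, the two factors coincide. -/
theorem quadForm_ne_zero {K : Type*} [Field K] [CharZero K] {α : K}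
    (hα : α ∉ Set.range ((↑) : ℚ → K)) {t N : ℚ} (h : α ^ 2 = t * α - N) {u v : ℚ}
    (huv : (u : K) - α * v ≠ 0) : u ^ 2 - t * u * v + N * v ^ 2 ≠ 0 := by
  intro h0
  have h0' : ((u : K) - α * v) * (u - (t - α) * v) = 0 := by
    have : ((u ^ 2 - t * u * v + N * v ^ 2 : ℚ) : K) = 0 := by rw [h0]; simp
    push_cast at this
    linear_combination this - (v : K) ^ 2 * h
  have h1 := (mul_eq_zero.1 h0').resolve_left huv
  by_cases hv : v = 0
  · subst hv
    simp at h1 huv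
    exact huv h1
  · have hv' : (v : K) ≠ 0 := by exact_mod_cast hv
    refine hα ⟨t - u / v, ?_⟩
    push_cast
    field_simp
    linear_combination -h1

/-! ### Growth of the denominators -/

theorem step_eq_or (n : ℕ) : (step 2 n : ℝ) = 2 ∧ (step 2 (n + 1) : ℝ) = 1 ∨
    (step 2 n : ℝ) = 1 ∧ (step 2 (n + 1) : ℝ) = 2 := by
  unfold step
  rcases Nat.even_or_odd n with hn | hn
  · left
    simp [hn, Nat.even_add_one]
  · right
    simp [Nat.not_even_iff_odd.2 hn, Nat.even_add_one]

/-- Only the odd-indexed factors, bounded by 1/2, contribute decay. -/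
theorem abs_prod_le {K : Type*} [Field K] (σinf : K →+* ℝ) {x : ℕ → K}
    (hinf : ∀ n, |σinf (x n)| ≤ (step 2 n : ℝ) / 2) (n : ℕ) :
    |σinf (∏ i ∈ Finset.range n, x i)| ≤ (1 / 2) ^ (n / 2) := by
  induction n with
  | zero => simp
  | succ n ih =>
    rw [Finset.prod_range_succ, map_mul, abs_mul]
    refine (mul_le_mul ih (hinf n) (abs_nonneg _) (by positivity)).trans (le_of_eq ?_)
    rcases Nat.even_or_odd' n with ⟨k, rfl | rfl⟩
    · rw [show (2 * k + 1) / 2 = 2 * k / 2 by omega]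
      simp [step]
    · rw [show (2 * k + 1 + 1) / 2 = (2 * k + 1) / 2 + 1 by omega, pow_succ]
      simp [step]

section Growth

variable {K : Type*} [Field K] [CharZero K] (σinf : K →+* ℝ) (σp : K →+* ℚ_[2])
  {a : ℕ → ℚ} {x : ℕ → K}

theorem abs_normalized_denom_le (hx0 : ∀ n, x n ≠ 0) (hx : ∀ n, x (n + 1) = 1 / x n - a n)
    (hinf : ∀ n, |σinf (x n)| ≤ (step 2 n : ℝ) / 2) (n : ℕ) :
    |σinf ((contProd a n 1 0 : K) * ∏ i ∈ Finset.range n, x i)| ≤ step 2 (n + 1) := by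
  induction n with
  | zero => simp [contProd]
  | succ n ih =>
    rw [normalized_denom_succ hx0 hx]
    set w := (contProd a n 1 0 : K) * ∏ i ∈ Finset.range n, x i
    rw [map_mul, map_sub, map_one, map_mul, abs_mul]
    have h1 : |1 - σinf (x n) * σinf w| ≤ 1 + |σinf (x n)| * |σinf w| := by
      refine (abs_sub _ _).trans ?_
      rw [abs_one, abs_mul]
    -- Consecutive steps multiply to 2, so the two bounds multiply to exactly 1.
    have h2 : |σinf (x n)| * |σinf w| ≤ 1 := by
      refine (mul_le_mul (hinf n) ih (abs_nonneg _) (by linarith [step_pos n])).trans ?_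
      rcases step_eq_or n with ⟨h, h'⟩ | ⟨h, h'⟩ <;> rw [h, h'] <;> norm_num
    have h3 : (step 2 (n + 1 + 1) : ℝ) = step 2 n := by
      simp [step, Nat.even_add_one]
    rw [h3]
    calc _ ≤ (step 2 n : ℝ) / 2 * 2 :=
          mul_le_mul (hinf n) (by linarith) (abs_nonneg _) (by linarith [step_pos n])
      _ = _ := by ring

theorem norm_normalized_denom_le (hx0 : ∀ n, x n ≠ 0) (hx : ∀ n, x (n + 1) = 1 / x n - a n)
    (hp : ∀ n, ‖σp (x n)‖ ≤ 1) (n : ℕ) :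
    ‖σp ((contProd a n 1 0 : K) * ∏ i ∈ Finset.range n, x i)‖ ≤ 1 := by
  induction n with
  | zero => simp [contProd]
  | succ n ih =>
    rw [normalized_denom_succ hx0 hx]
    set w := (contProd a n 1 0 : K) * ∏ i ∈ Finset.range n, x i
    rw [map_mul, map_sub, map_one, map_mul, norm_mul, sub_eq_add_neg]
    refine mul_le_one₀ (hp n) (norm_nonneg _) ((Padic.nonarchimedean _ _).trans (max_le ?_ ?_))
    · simp
    · rw [norm_neg, norm_mul]
      exact mul_le_one₀ (hp n) (norm_nonneg _) ih

/-- The linear factors of the norm form at the point `contProd a n *ᵥ (X, 1)`. -/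
theorem quadForm_contProd_eq (hx0 : ∀ n, x n ≠ 0) (hx : ∀ n, x (n + 1) = 1 / x n - a n)
    {t N : ℚ} (h : x 0 ^ 2 = t * x 0 - N) (X : ℚ) (n : ℕ) {u v : ℚ}
    (hu : u = contProd a n 0 1 + contProd a n 0 0 * X)
    (hv : v = contProd a n 1 1 + contProd a n 1 0 * X) :
    (u : K) - x 0 * v = (-1) ^ n * (∏ i ∈ Finset.range n, x i) * (X - x n) ∧
    ((u ^ 2 - t * u * v + N * v ^ 2 : ℚ) : K) = (X - x n) *
      ((∏ i ∈ Finset.range n, x i) ^ 2 * (X - x n) + (-1) ^ n * (2 * x 0 - t) *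
        (1 + (contProd a n 1 0 : K) * (∏ i ∈ Finset.range n, x i) * (X - x n))) := by
  obtain ⟨h0, h1⟩ := contProd_zero_sub hx0 hx n
  have h2 := contProd_one_mul_prod hx0 hx n
  have hu' : (u : K) - x 0 * v = (-1) ^ n * (∏ i ∈ Finset.range n, x i) * (X - x n) := by
    rw [hu, hv]
    push_cast
    linear_combination h1 + X * h0
  refine ⟨hu', ?_⟩
  -- The possibly large v appears only multiplied by the product taken from the other linear factor;
  -- together they are controlled by the normalized denominator.
  have hv' : (v : K) * (∏ i ∈ Finset.range n, x i) =
      1 + (contProd a n 1 0 : K) * (∏ i ∈ Finset.range n, x i) * (X - x n) := by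
    rw [hv, ← h2]
    push_cast
    ring
  have hsq : ((-1 : K) ^ n) ^ 2 = 1 := by rw [← pow_mul, mul_comm, pow_mul]; simp
  have hf : ((u ^ 2 - t * u * v + N * v ^ 2 : ℚ) : K) =
      ((u : K) - x 0 * v) * ((u - x 0 * v) + (2 * x 0 - t) * v) := by
    push_cast
    linear_combination (v : K) ^ 2 * h
  rw [hf, hu', ← hv']
  linear_combination (∏ i ∈ Finset.range n, x i) ^ 2 * (X - x n) ^ 2 * hsq

/-- The complete quotients of a quadratic irrational stay away from the boundary of the domain. -/
theorem exists_le_sub_abs {t N : ℚ} (h : x 0 ^ 2 = t * x 0 - N)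
    (hirr : ∀ n, x n ∉ Set.range ((↑) : ℚ → K)) (hx : ∀ n, x (n + 1) = 1 / x n - a n)
    (ha : ∀ n, a n ∈ dyadic) (hinf : ∀ n, |σinf (x n)| ≤ (step 2 n : ℝ) / 2)
    (hp : ∀ n, ‖σp (x n)‖ ≤ 1) :
    ∃ c : ℝ, 0 < c ∧ ∀ n, c ≤ (step 2 n : ℝ) / 2 - |σinf (x n)| := by
  have hx0 : ∀ n, x n ≠ 0 := fun n h => hirr n ⟨0, by simp [h]⟩
  obtain ⟨C, hC, hform⟩ := exists_le_abs_mul_norm_quadForm t N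
  -- With δ = X - x_n, P the product of the first n quotients and w the normalized denominator: |P|
  -- ≤ 1, |δ| ≤ 2, |w| ≤ 2 give 2 and 5 = 1 + 2·2. For B, the 2-adic bounds 1, 3, 1 give 3 and 4 = 1
  -- + 1·3, the outer 3 bounding δ itself.
  set A : ℝ := 2 + |σinf (2 * x 0 - t)| * 5 with hA
  set B : ℝ := 3 * (3 + ‖σp (2 * x 0 - t)‖ * 4) with hB
  have hApos : 0 < A := by positivity
  have hBpos : 0 < B := by positivity
  refine ⟨C / (A * B), by positivity, fun n => ?_⟩
  -- X is the endpoint ±s_n/2 with the sign of x_n, so its distance to x_n is exactly the gap to be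
  -- bounded.
  obtain ⟨X, hX, hXd, hXle, hXp⟩ : ∃ X : ℚ, |(X : ℝ) - σinf (x n)| ≤
      (step 2 n : ℝ) / 2 - |σinf (x n)| ∧ X ∈ dyadic ∧ |(X : ℝ)| ≤ 1 ∧ ‖(X : ℚ_[2])‖ ≤ 2 := by
    have hd : (step 2 n : ℚ) * (1 / 2) ∈ dyadic := mul_mem (natCast_mem _ _) half_mem_dyadic
    have hd1 : |(((step 2 n : ℚ) * (1 / 2) : ℚ) : ℝ)| ≤ 1 := by
      push_cast
      rcases step_eq_or n with ⟨h, -⟩ | ⟨h, -⟩ <;> rw [h] <;> norm_num [abs_of_pos]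
    have hd2 : ‖(((step 2 n : ℚ) * (1 / 2) : ℚ) : ℚ_[2])‖ ≤ 2 := by
      have e3 : ‖(2 : ℚ_[2])‖ = 2⁻¹ := by simpa using Padic.norm_p (p := 2)
      have h1 := Padic.norm_int_le_one (p := 2) (step 2 n : ℤ)
      push_cast at h1 ⊢
      rw [norm_mul, norm_div, norm_one, e3]
      linarith
    rcases le_total 0 (σinf (x n)) with hs | hs
    · refine ⟨(step 2 n : ℚ) * (1 / 2), ?_, hd, hd1, hd2⟩
      have := hinf n
      rw [abs_of_nonneg hs] at this ⊢
      push_cast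
      rw [abs_of_nonneg] <;> linarith
    · refine ⟨-((step 2 n : ℚ) * (1 / 2)), ?_, neg_mem hd, ?_, ?_⟩
      · have := hinf n
        rw [abs_of_nonpos hs] at this ⊢
        push_cast
        rw [abs_of_nonpos] <;> linarith
      · rwa [Rat.cast_neg, abs_neg]
      · rwa [Rat.cast_neg, norm_neg]
  refine le_trans ?_ hX
  obtain ⟨h1, h2⟩ := quadForm_contProd_eq hx0 hx h X n rfl rfl
  set u := contProd a n 0 1 + contProd a n 0 0 * X with hu
  set v := contProd a n 1 1 + contProd a n 1 0 * X with hv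
  have hud : u ∈ dyadic := add_mem (contProd_mem_dyadic ha n _ _)
    (mul_mem (contProd_mem_dyadic ha n _ _) hXd)
  have hvd : v ∈ dyadic := add_mem (contProd_mem_dyadic ha n _ _)
    (mul_mem (contProd_mem_dyadic ha n _ _) hXd)
  have hne : (u : K) - x 0 * v ≠ 0 := by
    rw [h1]
    refine mul_ne_zero (mul_ne_zero (by simp) (Finset.prod_ne_zero_iff.2 fun i _ => hx0 i))
      (sub_ne_zero.2 fun h => hirr n ⟨X, h⟩)
  have hlow := hform u hud v hvd (quadForm_ne_zero (hirr 0) h hne)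
  set f := u ^ 2 - t * u * v + N * v ^ 2
  have hw := abs_normalized_denom_le σinf hx0 hx hinf n
  have hwp := norm_normalized_denom_le σp hx0 hx hp n
  have hP : |σinf (∏ i ∈ Finset.range n, x i)| ≤ 1 :=
    (abs_prod_le σinf hinf n).trans (pow_le_one₀ (by norm_num) (by norm_num))
  have hPp : ‖σp (∏ i ∈ Finset.range n, x i)‖ ≤ 1 := by
    rw [map_prod, norm_prod]
    exact Finset.prod_le_one (fun _ _ => norm_nonneg _) fun i _ => hp i
  set P := ∏ i ∈ Finset.range n, x i
  set w := (contProd a n 1 0 : K) * P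
  have hw2 : |σinf w| ≤ 2 := hw.trans (by
    rcases step_eq_or n with ⟨-, h⟩ | ⟨-, h⟩ <;> norm_num [h])
  have hx1 : |σinf (x n)| ≤ 1 :=
    (hinf n).trans (by rcases step_eq_or n with ⟨h, -⟩ | ⟨h, -⟩ <;> rw [h] <;> norm_num)
  set δ := (X : K) - x n with hδ
  have hδr : σinf δ = X - σinf (x n) := by rw [hδ, map_sub, map_ratCast]
  rw [← hδr]
  have hδ2 : |σinf δ| ≤ 2 := by
    rw [hδr]; exact (abs_sub _ _).trans (by linarith)
  have hδp : ‖σp δ‖ ≤ 3 := by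
    rw [hδ, map_sub, map_ratCast]
    exact (norm_sub_le _ _).trans (by linarith [hp n])
  have hup : |(f : ℝ)| ≤ |σinf δ| * A := by
    rw [← map_ratCast σinf f, h2, map_mul, abs_mul]
    refine mul_le_mul_of_nonneg_left ?_ (abs_nonneg _)
    rw [map_add, map_mul, map_mul, map_mul, map_add, map_mul, map_one, map_pow, map_pow, map_neg,
      map_one]
    refine (abs_add_le _ _).trans (add_le_add ?_ ?_)
    · rw [abs_mul, abs_pow]
      calc _ ≤ 1 * 2 := mul_le_mul (pow_le_one₀ (abs_nonneg _) hP) hδ2 (abs_nonneg _) zero_le_one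
        _ = 2 := by norm_num
    · rw [abs_mul, abs_mul, abs_pow, abs_neg, abs_one, one_pow, one_mul]
      refine mul_le_mul_of_nonneg_left ((abs_add_le _ _).trans ?_) (abs_nonneg _)
      rw [abs_one, abs_mul]
      nlinarith [mul_le_mul hw2 hδ2 (abs_nonneg _) zero_le_two]
  have hupp : ‖(f : ℚ_[2])‖ ≤ B := by
    rw [← map_ratCast σp f, h2, map_mul, norm_mul]
    refine mul_le_mul hδp ?_ (norm_nonneg _) (by norm_num)
    rw [map_add, map_mul, map_mul, map_mul, map_add, map_mul, map_one, map_pow, map_pow, map_neg,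
      map_one]
    refine (norm_add_le _ _).trans (add_le_add ?_ ?_)
    · rw [norm_mul, norm_pow]
      calc _ ≤ 1 * 3 := mul_le_mul (pow_le_one₀ (norm_nonneg _) hPp) hδp (norm_nonneg _) zero_le_one
        _ = 3 := by norm_num
    · rw [norm_mul, norm_mul, norm_pow, norm_neg, norm_one, one_pow, one_mul]
      refine mul_le_mul_of_nonneg_left ((norm_add_le _ _).trans ?_) (norm_nonneg _)
      rw [norm_one, norm_mul]
      nlinarith [mul_le_mul hwp hδp (norm_nonneg _) zero_le_one]
  rw [div_le_iff₀ (by positivity), ← mul_assoc]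
  exact hlow.trans (mul_le_mul hup hupp (norm_nonneg _) (by positivity))

theorem tendsto_abs_contProd {t N : ℚ} (h : x 0 ^ 2 = t * x 0 - N)
    (hirr : ∀ n, x n ∉ Set.range ((↑) : ℚ → K)) (hx : ∀ n, x (n + 1) = 1 / x n - a n)
    (ha : ∀ n, a n ∈ dyadic) (hinf : ∀ n, |σinf (x n)| ≤ (step 2 n : ℝ) / 2)
    (hp : ∀ n, ‖σp (x n)‖ ≤ 1) :
    Tendsto (fun n => |(contProd a n 1 1 : ℝ)|) atTop atTop := by
  have hx0 : ∀ n, x n ≠ 0 := fun n h => hirr n ⟨0, by simp [h]⟩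
  obtain ⟨c, hc, hlow⟩ := exists_le_sub_abs σinf σp h hirr hx ha hinf hp
  have hgrow : Tendsto (fun n : ℕ => c * 2 ^ (n / 2)) atTop atTop :=
    ((tendsto_pow_atTop_atTop_of_one_lt one_lt_two).comp
      (Nat.tendsto_div_const_atTop two_ne_zero)).const_mul_atTop hc
  refine tendsto_atTop_mono (fun n => ?_) hgrow
  have e := congrArg σinf (contProd_one_mul_prod hx0 hx n)
  have hw := abs_normalized_denom_le σinf hx0 hx hinf n
  have hP := abs_prod_le σinf hinf n
  set P := ∏ i ∈ Finset.range n, x i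
  have e1 : (contProd a n 1 1 : ℝ) * σinf P = 1 - σinf (contProd a n 1 0 * P) * σinf (x n) := by
    simp only [map_mul, map_add, map_ratCast, map_one] at e ⊢
    linear_combination e
  -- As s_n s_{n+1} = 2, 1 - s_{n+1}|x_n| = s_{n+1}(s_n/2 - |x_n|) ≥ c.
  have h1 : c ≤ |(contProd a n 1 1 : ℝ)| * |σinf P| := by
    rw [← abs_mul, e1]
    refine le_trans ?_ (le_abs_self _)
    have h2 : σinf (contProd a n 1 0 * P) * σinf (x n) ≤ step 2 (n + 1) * |σinf (x n)| := by
      refine (le_abs_self _).trans ?_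
      rw [abs_mul]
      exact mul_le_mul_of_nonneg_right hw (abs_nonneg _)
    have h3 := hlow n
    rcases step_eq_or n with ⟨h, h'⟩ | ⟨h, h'⟩ <;> rw [h] at h3 <;> rw [h'] at h2 <;> linarith
  have h2 : c ≤ |(contProd a n 1 1 : ℝ)| * (1 / 2) ^ (n / 2) :=
    h1.trans (mul_le_mul_of_nonneg_left hP (abs_nonneg _))
  calc c * 2 ^ (n / 2) ≤ |(contProd a n 1 1 : ℝ)| * (1 / 2) ^ (n / 2) * 2 ^ (n / 2) := by gcongr
    _ = _ := by rw [mul_assoc, ← mul_pow]; norm_num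

end Growth

/-! ### The two algorithms -/

section Algorithms

variable {K : Type*} [Field K] (σinf : K →+* ℝ) (σp : K →+* ℚ_[2])

theorem convMatrix₂_eq_contProd (α : K) (n : ℕ) :
    convMatrix₂ 2 σinf σp α n = contProd (fun n => a 2 σinf σp α (n + 1)) n := by
  induction n with
  | zero => rfl
  | succ n ih => rw [convMatrix₂, contProd, ih]

theorem tendsto_abs_q₂ [CharZero K] [Algebra ℚ K] (hK : Module.finrank ℚ K = 2) {α : K}
    (hα : α ∉ Set.range ((↑) : ℚ → K)) (hinf : |σinf α| ≤ 1) (hp : ‖σp α‖ ≤ 1) :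
    Tendsto (fun n : ℕ => |(q₂ 2 σinf σp α n : ℝ)|) atTop atTop := by
  obtain ⟨t, N, h⟩ := exists_sq_eq_of_finrank_eq_two hK hα
  simp only [q₂, convMatrix₂_eq_contProd]
  -- The shift by one matches parities: the quotient at n + 1 is a remainder of the step indexed n +
  -- 1, while the starting value takes the even bound 1.
  refine tendsto_abs_contProd σinf σp (x := fun n => alphaT 2 σinf σp α (n + 1)) h
    (fun n => alphaT_notMem_rat 2 σinf σp hα (n + 1)) (fun n => rfl)
    (fun n => bFun_mem_dyadic σinf σp _ _) (fun n => ?_) fun n => ?_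
  · cases n with
    | zero => simpa [step, alphaT] using hinf
    | succ n => exact abs_sub_bFun_le σinf σp _ _
  · cases n with
    | zero => exact hp
    | succ n =>
      refine (norm_sub_bFun_le σinf σp _ _).trans ?_
      rcases step_eq_or (n + 1) with ⟨-, h⟩ | ⟨-, h⟩ <;> rw [h] <;> norm_num

/-- After its first step, the first algorithm is the second one applied to `α - b_0`. -/
theorem alphaT_sub_b (α : K) (n : ℕ) :
    alphaT 2 σinf σp (α - b 2 σinf σp α 0) (n + 1) =
      alpha 2 σinf σp α n - b 2 σinf σp α n := by
  induction n with
  | zero => rfl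
  | succ n ih => rw [alphaT, T, aFun, ih]; rfl

theorem a_sub_b (α : K) (n : ℕ) :
    a 2 σinf σp (α - b 2 σinf σp α 0) (n + 1) = b 2 σinf σp α (n + 1) := by
  rw [a, aFun, alphaT_sub_b]; rfl

/-- b_0 enters only the top row of the first product. The bottom rows start as (1, 0) and (0, 1) and
obey the same recursion with the columns exchanged. -/
theorem convMatrix₁_one_eq (α : K) (n : ℕ) :
    convMatrix₁ 2 σinf σp α n 1 0 = convMatrix₂ 2 σinf σp (α - b 2 σinf σp α 0) n 1 1 ∧
    convMatrix₁ 2 σinf σp α n 1 1 = convMatrix₂ 2 σinf σp (α - b 2 σinf σp α 0) n 1 0 := by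
  induction n with
  | zero => simp [convMatrix₁, convMatrix₂]
  | succ n ih =>
    simp [convMatrix₁, convMatrix₂, Matrix.mul_apply, Fin.sum_univ_two, ih.1, ih.2, a_sub_b,
      add_comm]

theorem tendsto_abs_q₁ [CharZero K] [Algebra ℚ K] (hK : Module.finrank ℚ K = 2) {α : K}
    (hα : α ∉ Set.range ((↑) : ℚ → K)) :
    Tendsto (fun n : ℕ => |(q₁ 2 σinf σp α n : ℝ)|) atTop atTop := by
  simp only [q₁, (convMatrix₁_one_eq σinf σp α _).1]
  refine tendsto_abs_q₂ σinf σp hK ?_ ?_ ?_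
  · rintro ⟨r, hr⟩
    exact hα ⟨r + b 2 σinf σp α 0, by push_cast; rw [hr]; ring⟩
  · exact (abs_sub_bFun_le σinf σp 0 α).trans (by simp [step])
  · refine (norm_sub_bFun_le σinf σp 0 α).trans ?_
    simp [step]
    norm_num

theorem PropertyI.abs_le_one {α : K} (h : PropertyI 2 σinf σp α) : |σinf α| ≤ 1 := by
  have := h.1
  norm_num at this
  exact abs_le.2 ⟨this.1.le, this.2⟩

theorem PropertyI.norm_le_one {α : K} (h : PropertyI 2 σinf σp α) : ‖σp α‖ ≤ 1 := by
  rcases eq_or_ne (σp α) 0 with h0 | h0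
  · simp [h0]
  · have h2 := h.2
    rw [Padic.addValuation.apply h0] at h2
    rw [Padic.norm_le_one_iff_val_nonneg]
    exact_mod_cast h2.le

end Algorithms

end SimulCF

theorem theorem3p19 {K : Type*} [Field K] [NumberField K] (hK : Module.finrank ℚ K = 2)
    (σinf : K →+* ℝ) (σp : K →+* ℚ_[2]) (α : K) (hα : α ∉ Set.range (algebraMap ℚ K)) :
    (SimulCF.PropertyI 2 σinf σp α →
      Tendsto (fun n : ℕ => |(SimulCF.q₂ 2 σinf σp α n : ℝ)|) atTop atTop) ∧
    Tendsto (fun n : ℕ => |(SimulCF.q₁ 2 σinf σp α n : ℝ)|) atTop atTop := by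
  have hα' : α ∉ Set.range ((↑) : ℚ → K) := by simpa using hα
  exact ⟨fun h => SimulCF.tendsto_abs_q₂ σinf σp hK hα' h.abs_le_one h.norm_le_one,
    SimulCF.tendsto_abs_q₁ σinf σp hK hα'⟩
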